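/- Let $m,n\ge 0$ and let $\mathbb{R}^m,\mathbb{R}^n$ carry positive definite inner products $\langle\cdot,\cdot\rangle$. Let $\Lambda\subset\mathbb{R}^m\times\mathbb{R}^n$ be an even, self-dual lattice of full rank $m+n$ for the Lorentzian product $(\alpha,\beta)\circ(\alpha',\beta')=\langle\alpha,\alpha'\rangle-\langle\beta,\beta'\rangle$. Put $$\Lambda_1^0=\{\alpha\in\mathbb{R}^m:(\alpha,0)\in\Lambda\},\qquad \Lambda_2^0=\{\beta\in\mathbb{R}^n:(0,\beta)\in\Lambda\},\qquad \Lambda_0=\Lambda_1^0\oplus\Lambda_2^0\subseteq\Lambda .$$ The modules $W_\mu$ of the Lorentzian lattice conformal field theory (LLCFT) based on $\Lambda$ are labelled by $[\mu]\in\Lambda/\Lambda_0$. Assume that this theory is rational, i.e. that $N:=|\Lambda/\Lambda_0|$ is finite. Let $(\alpha_\ell,\beta_\ell)\in\Lambda$, $\ell=1,\dots,N$, be representatives of the $N$ cosets, and write $0$ for the index of the trivial coset. The fusion coefficients of the theory are $\mathcal{N}_{\ell_1\ell_2}^{\ell_3}=1$ if $[(\alpha_{\ell_3},\beta_{\ell_3})]=[(\alpha_{\ell_1},\beta_{\ell_1})]+[(\alpha_{\ell_2},\beta_{\ell_2})]$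 in $\Lambda/\Lambda_0$, and $\mathcal{N}_{\ell_1\ell_2}^{\ell_3}=0$ otherwise. For $\operatorname{Im}\tau>0$ let $$\Theta_{L+\alpha}(\tau)=\sum_{\alpha'\in L+\alpha}e^{\pi i\tau\langle\alpha',\alpha'\rangle},\qquad \chi^L_{\alpha}(\tau)=\frac{\Theta_{\Lambda_1^0+\alpha}(\tau)}{\eta(\tau)^m},\qquad \chi^R_{\beta}(\tau)=\frac{\Theta_{\Lambda_2^0+\beta}(\tau)}{\eta(\tau)^n},$$ where $\eta$ is the Dedekind eta function. Then the theta series $\Theta_{\Lambda_1^0+\alpha_\ell}(\tau)$ and $\Theta_{\Lambda_2^0+\beta_\ell}(\tau)$ converge absolutely, and there exist $N\times N$ matrices $\mathcal{T}^L,\mathcal{T}^R,\mathcal{S}^L,\mathcal{S}^R$, given by $$\mathcal{T}^L_{\ell\ell'}=e^{\pi i(\langle\alpha_\ell,\alpha_\ell\rangle-m/12)}\delta_{\ell\ell'},\qquad \mathcal{T}^R_{\ell\ell'}=e^{\pi i(\langle\beta_\ell,\beta_\ell\rangle-n/12)}\delta_{\ell\ell'},$$ $$\mathcal{S}^L_{\ell\ell'}=\tfrac{1}{\sqrt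 N}e^{-2\pi i\langle\alpha_\ell,\alpha_{\ell'}\rangle},\qquad \mathcal{S}^R_{\ell\ell'}=\tfrac{1}{\sqrt N}e^{-2\pi i\langle\beta_\ell,\beta_{\ell'}\rangle},$$ such that, for all $\ell$ and all $\tau$ with $\operatorname{Im}\tau>0$, $$\chi^L_{\alpha_\ell}(\tau+1)=\sum_{\ell'}\mathcal{T}^L_{\ell\ell'}\chi^L_{\alpha_{\ell'}}(\tau),\qquad \chi^R_{\beta_\ell}(\tau+1)=\sum_{\ell'}\mathcal{T}^R_{\ell\ell'}\chi^R_{\beta_{\ell'}}(\tau),$$ $$\chi^L_{\alpha_\ell}(-1/\tau)=\sum_{\ell'}\mathcal{S}^L_{\ell\ell'}\chi^L_{\alpha_{\ell'}}(\tau),\qquad \chi^R_{\beta_\ell}(-1/\tau)=\sum_{\ell'}\mathcal{S}^R_{\ell\ell'}\chi^R_{\beta_{\ell'}}(\tau).$$ If $m-n\equiv 0\bmod 24$, then $\mathcal{T}^L=\mathcal{T}^R$ and $\mathcal{S}^L=\mathcal{S}^R$. Moreover, each of $\mathcal{S}=\mathcal{S}^L$ and $\mathcal{S}=\mathcal{S}^R$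 satisfies the Verlinde formula: for all $\ell_1,\ell_2,\ell_3$, $$\mathcal{N}_{\ell_1\ell_2}^{\ell_3}=\sum_{\ell=1}^N\frac{\mathcal{S}_{\ell_1\ell}\,\mathcal{S}_{\ell_2\ell}\,\overline{\mathcal{S}_{\ell\ell_3}}}{\mathcal{S}_{0\ell}} .$$ -/

import Mathlib

namespace LLCFT

noncomputable section

variable {E F : Type*} [NormedAddCommGroup E] [InnerProductSpace ℝ E]
  [NormedAddCommGroup F] [InnerProductSpace ℝ F]

/-- The Lorentzian product `⟨α, α'⟩ - ⟨β, β'⟩` of `(α, β)` and `(α', β')`. -/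
def lorentz (v w : E × F) : ℝ :=
  inner ℝ v.1 w.1 - inner ℝ v.2 w.2

/-- `Λ` is an even, self-dual Lorentzian lattice: a full-rank lattice in `E × F` whose vectors have
even Lorentzian square, and which equals its own dual for the Lorentzian product. -/
structure IsEvenSelfDualLattice (Λ : Submodule ℤ (E × F)) : Prop where
  discrete : DiscreteTopology Λ
  span_eq_top : Submodule.span ℝ (Λ : Set (E × F)) = ⊤
  even : ∀ v ∈ Λ, ∃ k : ℤ, lorentz v v = 2 * (k : ℝ)
  selfDual : ∀ v : E × F, v ∈ Λ ↔ ∀ w ∈ Λ, ∃ k : ℤ, lorentz v w = (k : ℝ)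

/-- `Λ₁⁰`: the vectors `α` with `(α, 0) ∈ Λ`, regarded as a lattice in `E`. -/
def leftLattice (Λ : Submodule ℤ (E × F)) : Submodule ℤ E :=
  Λ.comap (LinearMap.inl ℤ E F)

/-- `Λ₂⁰`: the vectors `β` with `(0, β) ∈ Λ`, regarded as a lattice in `F`. -/
def rightLattice (Λ : Submodule ℤ (E × F)) : Submodule ℤ F :=
  Λ.comap (LinearMap.inr ℤ E F)

/-- `Λ₀ = Λ₁⁰ ⊕ Λ₂⁰`, as a set of vectors of `E × F`. -/
def chiralLattice (Λ : Submodule ℤ (E × F)) : Submodule ℤ (E × F) :=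
  (leftLattice Λ).prod (rightLattice Λ)

/-- The group `Λ / Λ₀`, which labels the modules `W_μ` of the Lorentzian lattice CFT. -/
abbrev ModuleLabel (Λ : Submodule ℤ (E × F)) : Type _ :=
  Λ ⧸ (chiralLattice Λ).submoduleOf Λ

/-- The Lorentzian lattice CFT based on `Λ` is rational: it has finitely many modules `W_μ`. -/
def IsRational (Λ : Submodule ℤ (E × F)) : Prop :=
  Finite (ModuleLabel Λ)

open Classical in
/-- The fusion coefficients `N_{μν}^ρ = δ_{ρ, μ+ν}` on `Λ / Λ₀`. -/
def fusionCoeff (Λ : Submodule ℤ (E × F)) (μ ν ρ : ModuleLabel Λ) : ℕ :=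
  if ρ = μ + ν then 1 else 0

/-- The summand `q^{⟨α', α'⟩/2}` with `α' = α + x` and `q = e^{2πiτ}`. -/
def thetaTerm (L : Submodule ℤ E) (α : E) (τ : ℂ) (x : L) : ℂ :=
  Complex.exp (2 * Real.pi * Complex.I * τ *
    ((inner ℝ (α + (x : E)) (α + (x : E)) / 2 : ℝ) : ℂ))

/-- The theta function `Θ_{L+α}(τ)` of the coset `L + α`. -/
def theta (L : Submodule ℤ E) (α : E) (τ : ℂ) : ℂ :=
  ∑' x : L, thetaTerm L α τ x

/-- The left-moving character `χ^L_α = η^{-m} Θ_{Λ₁⁰+α}`, where `m = dim E`. -/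
def leftCharacter (Λ : Submodule ℤ (E × F)) (α : E) (τ : ℂ) : ℂ :=
  theta (leftLattice Λ) α τ / ModularForm.eta τ ^ Module.finrank ℝ E

/-- The right-moving character `χ^R_β = η^{-n} Θ_{Λ₂⁰+β}`, where `n = dim F`. -/
def rightCharacter (Λ : Submodule ℤ (E × F)) (β : F) (τ : ℂ) : ℂ :=
  theta (rightLattice Λ) β τ / ModularForm.eta τ ^ Module.finrank ℝ F

/-- The Verlinde formula for the matrix `S`, whose rows and columns are indexed by representatives
`rep` of the cosets in `Λ / Λ₀`; `o` is the index of the trivial coset. -/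
def VerlindeFormula (Λ : Submodule ℤ (E × F)) {N : ℕ} (rep : Fin N → Λ) (o : Fin N)
    (S : Matrix (Fin N) (Fin N) ℂ) : Prop :=
  ∀ i j k : Fin N,
    (fusionCoeff Λ (Submodule.Quotient.mk (rep i)) (Submodule.Quotient.mk (rep j))
        (Submodule.Quotient.mk (rep k)) : ℂ) =
      ∑ l : Fin N, S i l * S j l * star (S l k) / S o l

end

end LLCFT

/-! Let `L` be `Λ₁⁰` and `P` the projection of `Λ` to `E`. Self-duality tested on vectors `(v, 0)`
says `P* = L`. Rationality gives `M ≠ 0` with `MΛ ⊆ Λ₀`, so `MP ⊆ L`; hence `L` has full rank, `P`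
is discrete, and double duality yields `L* = P`. Either component of a vector of `Λ` determines its
class modulo `Λ₀`, so the `α l` represent `L*/L` (`IsCosetReps.isDualReps`). The right-moving side
is the same argument with the factors exchanged.

Poisson summation of a Gaussian (`hasSum_poisson_pi`) turns the theta series of `L + α l` at `-1/τ`
into a sum over `L*`, which regroups by cosets. The constant is found without covolumes: at the
fixed point `τ = i`, orthogonality of characters forces `c²N = 1` (`IsDualReps.theta_inversion`).
The factor `(-iτ)^(m/2)` cancels against that of `η^m`.

Evenness gives the law for `τ + 1`, evenness and integrality identify the left and right matrices,
and the Verlinde formula is orthogonality on `L*/L` (`IsDualReps.sum_phase`). -/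

open MeasureTheory Complex
set_option linter.unusedSectionVars false

/-! ### Poisson summation on `ι → ℝ` -/

/-- The translates of the half-open unit cube by integral vectors cover `ι → ℝ`. -/
lemma iUnion_Ioc_int_eq_univ {ι : Type*} :
    ⋃ k : ι → ℤ, {x : ι → ℝ | ∀ i, x i ∈ Set.Ioc (k i : ℝ) (k i + 1)} = Set.univ := by
  refine Set.eq_univ_of_forall fun x => Set.mem_iUnion.2 ⟨fun i => ⌈x i⌉ - 1, fun i => ?_⟩
  have h1 := Int.ceil_lt_add_one (x i)
  have h2 := Int.le_ceil (x i)
  constructor <;> push_cast <;> linarith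

lemma pairwise_disjoint_Ioc_int {ι : Type*} :
    Pairwise (Function.onFun Disjoint
      fun k : ι → ℤ => {x : ι → ℝ | ∀ i, x i ∈ Set.Ioc (k i : ℝ) (k i + 1)}) := by
  intro k l hkl
  refine Set.disjoint_left.2 fun x hx hy => hkl (funext fun i => ?_)
  have h1 : (k i : ℝ) < l i + 1 := (hx i).1.trans_le (hy i).2
  have h2 : (l i : ℝ) < k i + 1 := (hy i).1.trans_le (hx i).2
  have h3 : k i < l i + 1 := by exact_mod_cast h1
  have h4 : l i < k i + 1 := by exact_mod_cast h2
  omega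

lemma measurableSet_Ioc_int {ι : Type*} [Fintype ι] (k : ι → ℤ) :
    MeasurableSet {x : ι → ℝ | ∀ i, x i ∈ Set.Ioc (k i : ℝ) (k i + 1)} := by
  simpa [Set.pi] using
    MeasurableSet.univ_pi fun i => measurableSet_Ioc (a := (k i : ℝ)) (b := (k i : ℝ) + 1)

/-- The integral over `ι → ℝ` is the sum of the integrals of the integral translates over the
unit cube. -/
lemma hasSum_integral_cube {ι : Type*} [Fintype ι] {G : Type*} [NormedAddCommGroup G]
    [NormedSpace ℝ G] {h : (ι → ℝ) → G} (hh : Integrable h) :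
    HasSum (fun k : ι → ℤ => ∫ x in {x : ι → ℝ | ∀ i, x i ∈ Set.Ioc (0 : ℝ) (0 + 1)},
      h (x + fun i => (k i : ℝ))) (∫ x, h x) := by
  have := hasSum_integral_iUnion (μ := volume) (f := h) (fun k => measurableSet_Ioc_int (ι := ι) k)
    pairwise_disjoint_Ioc_int hh.integrableOn
  rw [iUnion_Ioc_int_eq_univ, Measure.restrict_univ] at this
  convert! this using 2 with k
  have hmp := measurePreserving_add_right (volume : Measure (ι → ℝ)) (fun i => (k i : ℝ))
  rw [← hmp.setIntegral_preimage_emb (measurableEmbedding_addRight _) h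
    {x : ι → ℝ | ∀ i, x i ∈ Set.Ioc (k i : ℝ) (k i + 1)}]
  congr 2
  ext x
  simp [add_comm (_ : ℝ) (k _ : ℝ)]

/-- The character `x ↦ exp (2πi n·x)` of `ι → ℝ`. -/
noncomputable def expDot {ι : Type*} [Fintype ι] (n : ι → ℤ) (x : ι → ℝ) : ℂ :=
  exp (2 * Real.pi * I * ((∑ i, (n i : ℝ) * x i : ℝ) : ℂ))

lemma mFourier_coe {ι : Type*} [Fintype ι] (n : ι → ℤ) (x : ι → ℝ) :
    UnitAddTorus.mFourier n (fun i => (x i : UnitAddCircle)) = expDot n x := by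
  simp only [UnitAddTorus.mFourier, ContinuousMap.coe_mk, fourier_coe_apply, expDot]
  rw [← Complex.exp_sum]
  congr 1
  push_cast
  rw [Finset.mul_sum]
  refine Finset.sum_congr rfl fun i _ => ?_
  simp; ring

lemma norm_expDot {ι : Type*} [Fintype ι] (n : ι → ℤ) (x : ι → ℝ) : ‖expDot n x‖ = 1 := by
  rw [expDot, show (2 * Real.pi * I * ((∑ i, (n i : ℝ) * x i : ℝ) : ℂ) : ℂ) =
    ((2 * Real.pi * (∑ i, (n i : ℝ) * x i) : ℝ) : ℂ) * I by push_cast; ring]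
  exact norm_exp_ofReal_mul_I _

lemma continuous_expDot {ι : Type*} [Fintype ι] (n : ι → ℤ) : Continuous (expDot n) := by
  unfold expDot; fun_prop

lemma coe_add_int {ι : Type*} (x : ι → ℝ) (k : ι → ℤ) :
    (fun i => (((x + fun i => (k i : ℝ)) i : ℝ) : UnitAddCircle)) =
      fun i => (x i : UnitAddCircle) := by
  funext i
  rw [Pi.add_apply, AddCircle.coe_add, add_eq_left, AddCircle.coe_eq_zero_iff]
  exact ⟨k i, by simp⟩

lemma expDot_add_int {ι : Type*} [Fintype ι] (n : ι → ℤ) (x : ι → ℝ) (k : ι → ℤ) :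
    expDot n (x + fun i => (k i : ℝ)) = expDot n x := by
  rw [← mFourier_coe, ← mFourier_coe, coe_add_int]

/-- Poisson summation for continuous functions on `ι → ℝ`. -/
theorem hasSum_poisson_pi {ι : Type*} [Fintype ι] {g : (ι → ℝ) → ℂ} (hg : Continuous g)
    (hint : Integrable g)
    (hloc : ∀ R : ℝ, ∃ u : (ι → ℤ) → ℝ, Summable u ∧
      ∀ (k : ι → ℤ) (x : ι → ℝ), ‖x‖ ≤ R → ‖g (x + fun i => (k i : ℝ))‖ ≤ u k)
    (hcoef : Summable fun n : ι → ℤ => ∫ x, expDot (-n) x * g x) (v : ι → ℝ) :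
    HasSum (fun n : ι → ℤ => (∫ x, expDot (-n) x * g x) * expDot n v)
      (∑' k : ι → ℤ, g (v + fun i => (k i : ℝ))) := by
  set G : (ι → ℝ) → ℂ := fun x => ∑' k : ι → ℤ, g (x + fun i => (k i : ℝ)) with hG
  have hGc : Continuous G := by
    rw [continuous_iff_continuousAt]
    intro x
    obtain ⟨u, hu, hb⟩ := hloc (‖x‖ + 1)
    have : ContinuousOn G (Metric.ball x 1) := by
      refine continuousOn_tsum (fun k => (by fun_prop : Continuous _).continuousOn) hu
        fun k y hy => hb k y ?_
      have h1 : ‖y - x‖ < 1 := by simpa [dist_eq_norm] using hy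
      have h2 := norm_add_le x (y - x)
      rw [add_sub_cancel] at h2
      linarith
    exact this.continuousAt (Metric.ball_mem_nhds x one_pos)
  have hGper : ∀ (x : ι → ℝ) (k : ι → ℤ), G (x + fun i => (k i : ℝ)) = G x := by
    intro x k
    simp only [hG]
    rw [← (Equiv.addLeft k).tsum_eq fun l : ι → ℤ => g (x + fun i => (l i : ℝ))]
    refine tsum_congr fun l => congrArg g ?_
    funext i
    simp; ring
  -- The periodisation `G` is constant on the fibres of the open quotient map to the torus, so it
  -- descends to a continuous function there, to which Fourier inversion applies.
  let π : (ι → ℝ) → UnitAddTorus ι := Pi.map fun _ x => (x : UnitAddCircle)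
  have hπ : IsOpenQuotientMap π := .piMap fun _ => QuotientAddGroup.isOpenQuotientMap_mk
  have hGπ : ∀ x y, π x = π y → G x = G y := by
    intro x y hxy
    have : ∀ i, ∃ k : ℤ, y i = x i + k := fun i => by
      have h := congrFun hxy i
      simp only [π, Pi.map_apply] at h
      rw [eq_comm, ← sub_eq_zero, ← AddCircle.coe_sub, AddCircle.coe_eq_zero_iff] at h
      obtain ⟨k, hk⟩ := h
      exact ⟨k, by simp at hk; linarith⟩
    choose k hk using this
    rw [show y = x + fun i => (k i : ℝ) from funext hk, hGper]
  let Fm : UnitAddTorus ι → ℂ := fun t => G (Function.surjInv hπ.surjective t)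
  have hF : ∀ x, Fm (π x) = G x := fun x => hGπ _ _ (Function.surjInv_eq hπ.surjective _)
  have hFc : Continuous Fm := by
    rw [hπ.isQuotientMap.continuous_iff]
    simpa [Function.comp_def, hF] using hGc
  let F : C(UnitAddTorus ι, ℂ) := ⟨Fm, hFc⟩
  -- Unfolding: the character is periodic, so the integral of character times periodisation over one
  -- cube is an integral over the whole space.
  have hcoeff : ∀ n, UnitAddTorus.mFourierCoeff F n = ∫ x, expDot (-n) x * g x := by
    intro n
    rw [UnitAddTorus.mFourierCoeff_eq_integral _ _ (0 : ι → ℝ)]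
    have hh : Integrable fun x => expDot (-n) x * g x :=
      hint.bdd_mul (c := 1) (continuous_expDot _).aestronglyMeasurable (by simp [norm_expDot])
    have h1 := hasSum_integral_cube hh
    have h2 := hasSum_integral_cube hh.norm
    have h3 := hasSum_integral_of_summable_integral_norm
      (μ := volume.restrict {x : ι → ℝ | ∀ i, x i ∈ Set.Ioc (0 : ℝ) (0 + 1)})
      (F := fun (k : ι → ℤ) x => expDot (-n) (x + fun i => (k i : ℝ)) *
        g (x + fun i => (k i : ℝ)))
      (fun k => ((measurePreserving_add_right volume _).integrable_comp_of_integrable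
        hh).integrableOn) h2.summable
    rw [h1.unique h3]
    simp only [Pi.zero_apply]
    congr 1
    funext x
    rw [mFourier_coe]
    change _ • Fm (π x) = _
    rw [hF, smul_eq_mul, hG, ← tsum_mul_left]
    simp only [expDot_add_int]
  have := UnitAddTorus.hasSum_mFourier_series_apply_of_summable (f := F)
    (by simpa only [funext hcoeff] using! hcoef) (π v)
  simp only [hcoeff] at this
  convert! this using 1
  · funext n
    rw [smul_eq_mul, ← mFourier_coe]; rfl
  · exact (hF v).symm

/-! ### Gaussian bounds and theta inversion up to a constant -/

/-- A Gaussian is summable over a lattice. -/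
lemma summable_exp_neg_norm_sq {E : Type*} [NormedAddCommGroup E] [NormedSpace ℝ E]
    [FiniteDimensional ℝ E] (L : Submodule ℤ E) [DiscreteTopology L] {a : ℝ} (ha : 0 < a) :
    Summable fun x : L => Real.exp (-a * ‖(x : E)‖ ^ 2) := by
  -- `exp (-t) ≤ n!/tⁿ` with `t = a‖x‖²` compares with `‖x‖^(-2n)`, summable because `2n` exceeds
  -- the rank. The bound fails only at `x = 0`, where the inverse is `0`.
  set n := Module.finrank ℤ L + 1
  have hs := (ZLattice.summable_norm_pow_inv L (2 * n) (by omega)).mul_left (n.factorial / a ^ n)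
  refine Summable.of_norm_bounded_eventually hs ?_
  refine (Set.finite_singleton (0 : L)).subset fun x hx => ?_
  by_contra h0
  refine hx ?_
  rw [Set.mem_ofPred_eq]
  have hx0 : 0 < ‖x‖ := norm_pos_iff.2 h0
  have h1 := Real.pow_div_factorial_le_exp (a * ‖x‖ ^ 2) (by positivity) n
  rw [Real.norm_eq_abs, abs_of_pos (Real.exp_pos _), neg_mul, Real.exp_neg,
    inv_le_comm₀ (Real.exp_pos _) (by positivity)]
  refine le_trans (le_of_eq ?_) h1
  rw [mul_pow, inv_pow, pow_mul]
  field_simp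

/-- From `‖x‖ ≤ ‖v + x‖ + ‖v‖` and `(a + b)² ≤ 2a² + 2b²`. It makes Gaussian bounds uniform for `v`
in a bounded set. -/
lemma norm_sq_div_two_sub_le {E : Type*} [SeminormedAddCommGroup E] (v x : E) :
    ‖x‖ ^ 2 / 2 - ‖v‖ ^ 2 ≤ ‖v + x‖ ^ 2 := by
  have h := norm_sub_le (v + x) v
  rw [add_sub_cancel_left] at h
  nlinarith [sq_nonneg (‖v + x‖ - ‖v‖), norm_nonneg x, norm_nonneg v, norm_nonneg (v + x)]

lemma norm_cexp_neg_mul_sq_le {E : Type*} [SeminormedAddCommGroup E] {B : ℂ} (hB : 0 < B.re)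
    {R : ℝ} (v x : E) (hv : ‖v‖ ≤ R) :
    ‖exp (-B * ‖v + x‖ ^ 2)‖ ≤
      Real.exp (B.re * R ^ 2) * Real.exp (-(B.re / 2) * ‖x‖ ^ 2) := by
  rw [Complex.norm_exp, ← Real.exp_add, Real.exp_le_exp]
  have h : (-B * (‖v + x‖ : ℂ) ^ 2).re = -B.re * ‖v + x‖ ^ 2 := by
    rw [← ofReal_pow, re_mul_ofReal, neg_re]
  rw [h]
  have h1 := mul_le_mul_of_nonneg_left (norm_sq_div_two_sub_le v x) hB.le
  have h2 := mul_le_mul_of_nonneg_left (pow_le_pow_left₀ (norm_nonneg v) hv 2) hB.le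
  linarith

section Gaussian

variable {E : Type*} [NormedAddCommGroup E] [InnerProductSpace ℝ E]

lemma thetaTerm_eq (L : Submodule ℤ E) (v : E) (τ : ℂ) (x : L) :
    LLCFT.thetaTerm L v τ x = exp (-(-(Real.pi * I * τ)) * ‖v + x‖ ^ 2) := by
  rw [LLCFT.thetaTerm, real_inner_self_eq_norm_sq]
  congr 1
  push_cast
  ring

lemma re_neg_pi_I_mul (τ : ℂ) : (-(Real.pi * I * τ)).re = Real.pi * τ.im := by
  simp [mul_assoc]

variable [FiniteDimensional ℝ E]

lemma summable_thetaTerm (L : Submodule ℤ E) [DiscreteTopology L] (v : E) {τ : ℂ}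
    (hτ : 0 < τ.im) : Summable (LLCFT.thetaTerm L v τ) := by
  have hB : 0 < (-(Real.pi * I * τ)).re := by rw [re_neg_pi_I_mul]; positivity
  refine Summable.of_norm_bounded ((summable_exp_neg_norm_sq L (half_pos hB)).mul_left
    (Real.exp ((-(Real.pi * I * τ)).re * ‖v‖ ^ 2))) fun x => ?_
  rw [thetaTerm_eq]
  exact norm_cexp_neg_mul_sq_le hB v x le_rfl

/-- Linear change of variables from coordinates to an inner product space. -/
lemma exists_integral_comp_equiv [MeasurableSpace E] [BorelSpace E] {ι : Type*} [Fintype ι]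
    (φ : (ι → ℝ) ≃L[ℝ] E) :
    ∃ c : ℝ, 0 < c ∧ ∀ f : E → ℂ, Integrable f →
      Integrable (fun x => f (φ x)) ∧ ∫ x, f (φ x) = c * ∫ v, f v := by
  have he : MeasurableEmbedding φ := φ.toHomeomorph.measurableEmbedding
  have hh : (Measure.map φ volume).IsAddHaarMeasure := φ.isAddHaarMeasure_map volume
  obtain ⟨c, hc, h⟩ : ∃ c : NNReal, 0 < c ∧ Measure.map φ volume = c • (volume : Measure E) :=
    ⟨_, Measure.addHaarScalarFactor_pos_of_isAddHaarMeasure _ _,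
      Measure.isAddLeftInvariant_eq_smul _ _⟩
  refine ⟨c, by exact_mod_cast hc, ?_⟩
  · intro f hf
    constructor
    · rw [← Function.comp_def, ← he.integrable_map_iff, h]
      exact hf.smul_measure_nnreal
    · rw [← he.integral_map, h, integral_smul_nnreal_measure]
      rfl

/-- The vector whose inner product with the `i`-th vector of `b` is `n i`. -/
noncomputable def dualVec {ι : Type*} (b : Module.Basis ι ℝ E) (n : ι → ℤ) : E :=
  (InnerProductSpace.toDual ℝ E).symm
    (LinearMap.toContinuousLinearMap (b.constr ℝ fun i => (n i : ℝ)))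

lemma inner_dualVec {ι : Type*} (b : Module.Basis ι ℝ E) (n : ι → ℤ) (i : ι) :
    inner ℝ (b i) (dualVec b n) = n i := by
  rw [real_inner_comm, dualVec, InnerProductSpace.toDual_symm_apply]
  simp [Module.Basis.constr_basis]

lemma inner_equivFun_symm_dualVec {ι : Type*} [Fintype ι] (b : Module.Basis ι ℝ E) (n : ι → ℤ)
    (x : ι → ℝ) : inner ℝ (b.equivFun.symm x) (dualVec b n) = ∑ i, (n i : ℝ) * x i := by
  simp [Module.Basis.equivFun_symm_apply, sum_inner, inner_smul_left, inner_dualVec, mul_comm]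

/-- The inversion formula for theta series of a lattice, up to the normalisation by the
covolume. -/
theorem exists_theta_inversion (L : Submodule ℤ E) [DiscreteTopology L] [IsZLattice ℝ L]
    {ι : Type*} [Fintype ι] (bL : Module.Basis ι ℤ L) :
    ∃ c : ℝ, 0 < c ∧ ∀ τ : ℂ, 0 < τ.im →
      (Summable fun n : ι → ℤ =>
        exp (Real.pi * I * τ * ‖dualVec (bL.ofZLatticeBasis ℝ L) n‖ ^ 2)) →
      ∀ v : E, LLCFT.theta L v (-1 / τ) =
        c * (-I * τ) ^ (Module.finrank ℝ E / 2 : ℂ) *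
          ∑' n : ι → ℤ, exp (Real.pi * I * τ * ‖dualVec (bL.ofZLatticeBasis ℝ L) n‖ ^ 2) *
            exp (2 * Real.pi * I * (inner ℝ v (dualVec (bL.ofZLatticeBasis ℝ L) n) : ℝ)) := by
  let _ : MeasurableSpace E := borel E
  have : BorelSpace E := ⟨rfl⟩
  set b := bL.ofZLatticeBasis ℝ L with hb
  let φ : (ι → ℝ) ≃L[ℝ] E := b.equivFun.symm.toContinuousLinearEquiv
  have hφ : ∀ x, φ x = b.equivFun.symm x := fun x => rfl
  obtain ⟨c, hc, hcint⟩ := exists_integral_comp_equiv φ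
  refine ⟨c, hc, fun τ hτ hsum v => ?_⟩
  have hτ0 : τ ≠ 0 := by rintro rfl; simp at hτ
  -- `B = πi/τ`, so that `exp (-B‖·‖²)` is the theta summand at `-1/τ` and `π/B = -iτ`.
  set B : ℂ := -(Real.pi * I * (-1 / τ)) with hBdef
  have hB : 0 < B.re := by
    rw [re_neg_pi_I_mul, neg_div, one_div, neg_im, inv_im]
    have := normSq_pos.2 hτ0
    rw [neg_div, neg_neg]
    positivity
  have hB0 : B ≠ 0 := by intro h; simp [h] at hB
  have hπ : (Real.pi : ℂ) ≠ 0 := by exact_mod_cast Real.pi_ne_zero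
  have hπB : Real.pi / B = -I * τ := by
    rw [hBdef]; field_simp; rw [I_sq, neg_neg]
  have hlat : ∀ k : ι → ℤ, φ (fun i => (k i : ℝ)) = bL.equivFun.symm k := by
    intro k
    rw [hφ, Module.Basis.equivFun_symm_apply, Module.Basis.equivFun_symm_apply]
    simp [hb, Int.cast_smul_eq_zsmul]
  have hcoef : ∀ n : ι → ℤ, ∫ x, expDot (-n) x * exp (-B * ‖φ x‖ ^ 2) =
      c * (-I * τ) ^ (Module.finrank ℝ E / 2 : ℂ) *
        exp (Real.pi * I * τ * ‖dualVec b n‖ ^ 2) := by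
    intro n
    -- In coordinates, `n · x` is the inner product with `dualVec b n`; the coefficient is thus the
    -- Fourier transform of the Gaussian at that dual vector.
    have hi := GaussianFourier.integrable_cexp_neg_mul_sq_norm_add hB (-(2 * Real.pi * I))
      (dualVec b n)
    have h1 := (hcint _ hi).2
    rw [GaussianFourier.integral_cexp_neg_mul_sq_norm_add hB, hπB] at h1
    rw [mul_assoc]
    convert! h1 using 3
    · rw [Complex.exp_add, mul_comm, hφ, real_inner_comm, inner_equivFun_symm_dualVec, expDot]
      congr 2
      push_cast
      simp
    · congr 1
      have : Real.pi * I * τ = -(Real.pi * Real.pi / B) := by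
        rw [mul_div_assoc, hπB]; ring
      rw [this]
      field_simp
      rw [I_sq]; ring
  have hgi := (hcint _ (GaussianFourier.integrable_cexp_neg_mul_sq_norm_add hB 0 (0 : E))).1
  have hP := hasSum_poisson_pi (g := fun x => exp (-B * ‖φ x‖ ^ 2)) (by fun_prop)
    (by simpa using hgi) ?_ (by simpa only [hcoef] using hsum.mul_left _) (φ.symm v)
  · simp only [hcoef] at hP
    rw [← tsum_mul_left, LLCFT.theta, ← bL.equivFun.symm.toEquiv.tsum_eq]
    convert hP.tsum_eq.symm using 1
    · refine tsum_congr fun k => ?_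
      rw [thetaTerm_eq, map_add, hlat, φ.apply_symm_apply]
      rfl
    · refine tsum_congr fun n => ?_
      rw [mul_assoc, expDot, ← inner_equivFun_symm_dualVec b, ← hφ, φ.apply_symm_apply]
      ring
  · intro R
    refine ⟨fun k => Real.exp (B.re * (‖(φ : (ι → ℝ) →L[ℝ] E)‖ * R) ^ 2) *
      Real.exp (-(B.re / 2) * ‖(bL.equivFun.symm k : E)‖ ^ 2), ?_, fun k x hx => ?_⟩
    · exact (bL.equivFun.symm.toEquiv.summable_iff.2
        (summable_exp_neg_norm_sq L (half_pos hB))).mul_left _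
    · rw [map_add, hlat]
      exact norm_cexp_neg_mul_sq_le hB _ _ (((φ : (ι → ℝ) →L[ℝ] E).le_opNorm x).trans
        (by gcongr))

end Gaussian

/-! ### Cosets of a lattice in its dual, and the normalised inversion formula -/

section DualLattice

variable {E : Type*} [NormedAddCommGroup E] [InnerProductSpace ℝ E]

/-- The vectors whose inner products with `L` are integral. -/
noncomputable def dualLattice (L : Submodule ℤ E) : Submodule ℤ E :=
  LinearMap.BilinForm.dualSubmodule (innerₗ E) L

lemma mem_dualLattice {L : Submodule ℤ E} {v : E} :
    v ∈ dualLattice L ↔ ∀ x ∈ L, ∃ k : ℤ, inner ℝ v x = k := by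
  simp only [dualLattice, LinearMap.BilinForm.mem_dualSubmodule, Submodule.mem_one, innerₗ_apply_apply,
    eq_comm, algebraMap_int_eq, eq_intCast]

/-- The phase `exp (-2πi⟨v, w⟩)`. -/
noncomputable def phase (v w : E) : ℂ :=
  exp (-2 * Real.pi * I * (inner ℝ v w : ℝ))

lemma phase_eq_one_iff {v w : E} : phase v w = 1 ↔ ∃ k : ℤ, inner ℝ v w = k := by
  rw [phase, Complex.exp_eq_one_iff]
  have h : (2 * Real.pi * I : ℂ) ≠ 0 := Complex.two_pi_I_ne_zero
  constructor
  · rintro ⟨n, hn⟩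
    refine ⟨-n, ?_⟩
    have : ((inner ℝ v w : ℝ) : ℂ) = ((-n : ℤ) : ℝ) := by
      refine mul_left_cancel₀ h ?_
      push_cast
      linear_combination -hn
    exact_mod_cast this
  · rintro ⟨k, hk⟩
    refine ⟨-k, ?_⟩
    rw [hk]
    push_cast
    ring

lemma phase_comm (v w : E) : phase v w = phase w v := by
  rw [phase, phase, real_inner_comm]

lemma phase_add_right (v w w' : E) : phase v (w + w') = phase v w * phase v w' := by
  rw [phase, phase, phase, ← Complex.exp_add, inner_add_right]
  congr 1
  push_cast
  ring

lemma phase_add_left (v v' w : E) : phase (v + v') w = phase v w * phase v' w := by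
  rw [phase_comm, phase_add_right, phase_comm w, phase_comm w]

lemma star_phase (v w : E) : star (phase v w) = phase (-v) w := by
  rw [phase, phase, ← starRingEnd_apply, ← Complex.exp_conj, inner_neg_left]
  congr 1
  simp [Complex.conj_ofNat]

/-- The vectors `α l` represent the cosets of an integral lattice `L` in its dual. -/
structure IsDualReps (L : Submodule ℤ E) {N : ℕ} (α : Fin N → E) : Prop where
  le_dual : L ≤ dualLattice L
  mem_dual : ∀ l, α l ∈ dualLattice L
  exists_sub_mem : ∀ v ∈ dualLattice L, ∃ l, v - α l ∈ L
  eq_of_sub_mem : ∀ l l', α l - α l' ∈ L → l = l'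
  mem_of_pairing : ∀ v ∈ dualLattice L, (∀ l, ∃ k : ℤ, inner ℝ v (α l) = k) → v ∈ L

variable {L : Submodule ℤ E} {N : ℕ} {α : Fin N → E}

-- Orthogonality of characters: if `v ∉ L`, some `α l₀` has phase different from `1`. Adding `α l₀`
-- permutes the cosets and multiplies the sum by that phase, so the sum vanishes.
open Classical in
lemma IsDualReps.sum_phase (h : IsDualReps L α) {v : E} (hv : v ∈ dualLattice L) :
    ∑ l, phase v (α l) = if v ∈ L then (N : ℂ) else 0 := by
  split_ifs with hvL
  · have : ∀ l, phase v (α l) = 1 := fun l => by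
      rw [phase_comm, phase_eq_one_iff]
      exact mem_dualLattice.1 (h.mem_dual l) v hvL
    simp [this]
  · obtain ⟨l₀, hl₀⟩ : ∃ l, phase v (α l) ≠ 1 := by
      by_contra! hc
      exact hvL (h.mem_of_pairing v hv fun l => phase_eq_one_iff.1 (hc l))
    choose σ hσ using fun l => h.exists_sub_mem (α l + α l₀)
      (add_mem (h.mem_dual l) (h.mem_dual l₀))
    have hinj : Function.Injective σ := fun l l' hll => h.eq_of_sub_mem l l' (by
      have := sub_mem (hσ l) (hσ l')
      rw [hll] at this
      convert this using 1
      abel)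
    have hph : ∀ l, phase v (α (σ l)) = phase v (α l) * phase v (α l₀) := fun l => by
      rw [← phase_add_right, ← sub_add_cancel (α l + α l₀) (α (σ l)),
        phase_add_right _ (_ - _), phase_eq_one_iff.2 (mem_dualLattice.1 hv _ (hσ l)), one_mul]
    have hsum : ∑ l, phase v (α (σ l)) = ∑ l, phase v (α l) :=
      (Equiv.ofBijective σ (Finite.injective_iff_bijective.1 hinj)).sum_comp fun l => phase v (α l)
    simp only [hph, ← Finset.sum_mul] at hsum
    have h2 : (∑ l, phase v (α l)) * (phase v (α l₀) - 1) = 0 := by linear_combination hsum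
    exact (mul_eq_zero.1 h2).resolve_right (sub_ne_zero.2 hl₀)

lemma equivFun_symm_intCast [FiniteDimensional ℝ E] [DiscreteTopology L] [IsZLattice ℝ L]
    {ι : Type*} [Fintype ι] (bL : Module.Basis ι ℤ L) (k : ι → ℤ) :
    (bL.ofZLatticeBasis ℝ L).equivFun.symm (fun i => (k i : ℝ)) = (bL.equivFun.symm k : E) := by
  rw [Module.Basis.equivFun_symm_apply, Module.Basis.equivFun_symm_apply]
  simp [Int.cast_smul_eq_zsmul]

/-- Dual vectors in coordinates, as translates of the lattice. -/
lemma IsDualReps.exists_equiv [FiniteDimensional ℝ E] [DiscreteTopology L] [IsZLattice ℝ L]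
    (h : IsDualReps L α) {ι : Type*} [Fintype ι] (bL : Module.Basis ι ℤ L) :
    ∃ e : Fin N × L ≃ (ι → ℤ), ∀ l x,
      dualVec (bL.ofZLatticeBasis ℝ L) (e (l, x)) = -(α l + x) := by
  set b := bL.ofZLatticeBasis ℝ L with hb
  -- The sign matches conventions: Poisson summation produces `exp (+2πi⟨v, ·⟩)`, whereas `phase`
  -- carries a minus.
  have hex : ∀ p : Fin N × L, ∃ n : ι → ℤ, dualVec b n = -(α p.1 + p.2) := by
    rintro ⟨l, x⟩
    have hm : -(α l + (x : E)) ∈ dualLattice L :=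
      neg_mem (add_mem (h.mem_dual l) (h.le_dual x.2))
    choose n hn using fun i => mem_dualLattice.1 hm (bL i) (bL i).2
    refine ⟨n, InnerProductSpace.ext_inner_left_basis b fun i => ?_⟩
    rw [inner_dualVec, real_inner_comm, hb, Module.Basis.ofZLatticeBasis_apply, hn]
  choose e he using hex
  refine ⟨Equiv.ofBijective e ⟨?_, fun n => ?_⟩, fun l x => he (l, x)⟩
  · rintro ⟨l, x⟩ ⟨l', x'⟩ hxx
    have h1 := he (l, x)
    rw [hxx, he, neg_inj] at h1
    simp only at h1
    obtain rfl : l = l' := h.eq_of_sub_mem l l' (by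
      rw [sub_eq_sub_iff_add_eq_add.2 (show α l + (x : E) = (x' : E) + α l' by rw [← h1, add_comm])]
      exact sub_mem x'.2 x.2)
    rw [add_right_inj] at h1
    rw [Subtype.ext h1]
  · have hm : -dualVec b n ∈ dualLattice L := neg_mem (mem_dualLattice.2 fun x hx => by
      have := inner_equivFun_symm_dualVec b n fun i => (bL.equivFun ⟨x, hx⟩ i : ℝ)
      rw [hb, equivFun_symm_intCast, LinearEquiv.symm_apply_apply] at this
      rw [real_inner_comm, this]
      exact ⟨∑ i, n i * bL.equivFun ⟨x, hx⟩ i, by push_cast; rfl⟩)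
    obtain ⟨l, hl⟩ := h.exists_sub_mem _ hm
    refine ⟨(l, ⟨_, hl⟩), funext fun i => ?_⟩
    have h1 := he (l, ⟨_, hl⟩)
    rw [add_sub_cancel, neg_neg] at h1
    have h2 := inner_dualVec b n i
    rw [← h1, inner_dualVec] at h2
    exact_mod_cast h2

/-- At `τ = i` every summand is a positive real. -/
lemma theta_I_ne_zero [FiniteDimensional ℝ E] [DiscreteTopology L] (v : E) : LLCFT.theta L v I ≠ 0 := by
  have h : ∀ x, LLCFT.thetaTerm L v I x = (Real.exp (-Real.pi * ‖v + (x : E)‖ ^ 2) : ℝ) := by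
    intro x
    rw [thetaTerm_eq]
    push_cast
    congr 1
    linear_combination (Real.pi * ‖v + (x : E)‖ ^ 2 : ℂ) * I_mul_I
  have hs := summable_thetaTerm L v (τ := I) (by simp)
  simp only [funext h] at hs
  rw [LLCFT.theta, funext h, ← ofReal_tsum, ofReal_ne_zero]
  exact ((Complex.summable_ofReal.1 hs).tsum_pos (fun _ => (Real.exp_pos _).le) 0
    (Real.exp_pos _)).ne'

variable [FiniteDimensional ℝ E] [DiscreteTopology L] [IsZLattice ℝ L]

/-- The sum over the dual lattice splits into cosets `α l' + L`; the phase against `α l` is constant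
on each because `α l` pairs integrally with `L`. -/
lemma IsDualReps.exists_theta_inversion (h : IsDualReps L α) :
    ∃ c : ℝ, 0 < c ∧ ∀ τ : ℂ, 0 < τ.im → ∀ l,
      LLCFT.theta L (α l) (-1 / τ) = c * (-I * τ) ^ (Module.finrank ℝ E / 2 : ℂ) *
        ∑ l', phase (α l) (α l') * LLCFT.theta L (α l') τ := by
  have : Module.Free ℤ L := ZLattice.module_free ℝ L
  have : Module.Finite ℤ L := ZLattice.module_finite ℝ L
  let bL := Module.Free.chooseBasis ℤ L
  obtain ⟨c, hc, H⟩ := _root_.exists_theta_inversion L bL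
  obtain ⟨e, he⟩ := h.exists_equiv bL
  refine ⟨c, hc, fun τ hτ l => ?_⟩
  have hterm : ∀ l' x, exp (Real.pi * I * τ *
      ‖dualVec (bL.ofZLatticeBasis ℝ L) (e (l', x))‖ ^ 2) = LLCFT.thetaTerm L (α l') τ x := by
    intro l' x
    rw [he, norm_neg, thetaTerm_eq, neg_neg]
  have hph : ∀ l' x, exp (2 * Real.pi * I *
      (inner ℝ (α l) (dualVec (bL.ofZLatticeBasis ℝ L) (e (l', x))) : ℝ)) =
      phase (α l) (α l') := by
    intro l' x
    have h1 : phase (α l) x = 1 := phase_eq_one_iff.2 (mem_dualLattice.1 (h.mem_dual l) x x.2)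
    rw [← mul_one (phase (α l) (α l')), ← h1, ← phase_add_right, he, phase, inner_neg_right]
    congr 1
    push_cast
    ring
  have hs : ∀ l', Summable (LLCFT.thetaTerm L (α l') τ) := fun l' => summable_thetaTerm L _ hτ
  have hsum : Summable fun n =>
      exp (Real.pi * I * τ * ‖dualVec (bL.ofZLatticeBasis ℝ L) n‖ ^ 2) := by
    rw [← e.summable_iff]
    refine Summable.of_norm ((summable_prod_of_nonneg fun _ => norm_nonneg _).2 ⟨fun l' => ?_, ?_⟩)
    · simpa only [Function.comp_apply, hterm] using (hs l').norm
    · exact (hasSum_fintype _).summable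
  rw [H τ hτ hsum]
  congr 1
  rw [← e.tsum_eq, Summable.tsum_prod, tsum_fintype]
  · simp only [hterm, hph, tsum_mul_right]
    exact Finset.sum_congr rfl fun l' _ => mul_comm _ _
  · refine Summable.of_norm ((summable_prod_of_nonneg fun _ => norm_nonneg _).2 ⟨fun l' => ?_, ?_⟩)
    · simpa only [hterm, hph] using ((hs l').mul_right _).norm
    · exact (hasSum_fintype _).summable

/-- The inversion formula for the theta series of the cosets of `L` in its dual. -/
theorem IsDualReps.theta_inversion (h : IsDualReps L α) {τ : ℂ} (hτ : 0 < τ.im) (l : Fin N) :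
    LLCFT.theta L (α l) (-1 / τ) = (-I * τ) ^ (Module.finrank ℝ E / 2 : ℂ) *
      ∑ l', 1 / (Real.sqrt N : ℂ) * phase (α l) (α l') * LLCFT.theta L (α l') τ := by
  obtain ⟨c, hc, H⟩ := h.exists_theta_inversion
  obtain ⟨o, ho⟩ := h.exists_sub_mem 0 (zero_mem _)
  rw [zero_sub, neg_mem_iff] at ho
  -- `τ = i` is fixed by `-1/τ` and there `-iτ = 1`, leaving a linear system for the theta values
  -- with `c` as the only unknown constant.
  have hI : ∀ l, LLCFT.theta L (α l) I = c * ∑ l', phase (α l) (α l') * LLCFT.theta L (α l') I := by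
    intro l
    have := H I (by simp) l
    rwa [neg_mul, I_mul_I, neg_neg, one_cpow, mul_one, neg_div, one_div, inv_I, neg_neg] at this
  have ho1 : ∀ l, phase (α o) (α l) = 1 := fun l => by
    rw [phase_comm, phase_eq_one_iff]
    exact mem_dualLattice.1 (h.mem_dual l) _ ho
  have hL : ∀ l, α l ∈ L → l = o := fun l hl => h.eq_of_sub_mem l o (sub_mem hl ho)
  -- Summing the system over `l`, orthogonality keeps only the trivial coset; its own equation has
  -- all phases `1`. Combining the two gives `c²N = 1`.
  have h1 : ∑ l, LLCFT.theta L (α l) I = c * (N * LLCFT.theta L (α o) I) := by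
    classical
    rw [Finset.sum_congr rfl fun l _ => hI l, ← Finset.mul_sum, Finset.sum_comm]
    have hcol : ∀ l', ∑ l, phase (α l) (α l') * LLCFT.theta L (α l') I =
        (if α l' ∈ L then (N : ℂ) else 0) * LLCFT.theta L (α l') I := fun l' => by
      rw [← Finset.sum_mul, ← h.sum_phase (h.mem_dual l')]
      simp only [phase_comm _ (α l')]
    simp only [hcol]
    rw [Finset.sum_eq_single o (fun l _ hlo => by rw [if_neg fun hl => hlo (hL l hl), zero_mul])
      (by simp), if_pos ho]
  have h2 : LLCFT.theta L (α o) I = c * c * N * LLCFT.theta L (α o) I := by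
    conv_lhs => rw [hI o]
    simp only [ho1, one_mul]
    rw [h1]; ring
  have h3 : (c * c * N : ℂ) = 1 := by
    have := theta_I_ne_zero (L := L) (α o)
    exact mul_right_cancel₀ this (by rw [one_mul, ← h2])
  have h4 : c * c * N = 1 := by exact_mod_cast h3
  have h5 : c * √N = 1 := by
    refine (pow_eq_one_iff_of_nonneg (by positivity) two_ne_zero).1 ?_
    rw [mul_pow, Real.sq_sqrt (Nat.cast_nonneg N), sq, h4]
  have h6 : (c : ℂ) = 1 / (√N : ℝ) := by
    rw [eq_div_iff_mul_eq]
    · exact_mod_cast h5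
    · rintro h0
      rw [ofReal_eq_zero.1 h0, mul_zero] at h5
      exact zero_ne_one h5
  rw [H τ hτ l, h6, mul_right_comm, mul_comm, Finset.mul_sum]
  simp only [mul_assoc]

end DualLattice

/-! ### Double duality -/

section DoubleDual

variable {E : Type*} [NormedAddCommGroup E] [InnerProductSpace ℝ E] [FiniteDimensional ℝ E]

lemma dualLattice_dualLattice (P : Submodule ℤ E) [DiscreteTopology P] [IsZLattice ℝ P] :
    dualLattice (dualLattice P) = P := by
  have : Module.Free ℤ P := ZLattice.module_free ℝ P
  have : Module.Finite ℤ P := ZLattice.module_finite ℝ P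
  have h := LinearMap.BilinForm.dualSubmodule_dualSubmodule_of_basis (R := ℤ) (innerₗ E)
    ?_ ?_ ((Module.Free.chooseBasis ℤ P).ofZLatticeBasis ℝ P)
  · rwa [Module.Basis.ofZLatticeBasis_span] at h
  · constructor
    · exact fun x hx => inner_self_eq_zero.1 (hx x)
    · exact fun x hx => inner_self_eq_zero.1 (hx x)
  · exact ⟨fun x y => real_inner_comm _ _⟩

end DoubleDual

/-! ### From the Lorentzian lattice to its chiral sublattices -/

namespace LLCFT

variable {E F : Type*} [NormedAddCommGroup E] [InnerProductSpace ℝ E]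
  [NormedAddCommGroup F] [InnerProductSpace ℝ F]

lemma mem_leftLattice {Λ : Submodule ℤ (E × F)} {x : E} :
    x ∈ leftLattice Λ ↔ (x, (0 : F)) ∈ Λ := Iff.rfl

lemma mem_rightLattice {Λ : Submodule ℤ (E × F)} {y : F} :
    y ∈ rightLattice Λ ↔ ((0 : E), y) ∈ Λ := Iff.rfl

/-- Subtracting `(w.1, 0)` leaves `(0, w.2)` in `Λ`. Hence classes modulo `Λ₀` can be compared on
one component. -/
lemma mem_chiralLattice_of_fst {Λ : Submodule ℤ (E × F)} {w : E × F} (hw : w ∈ Λ)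
    (h : w.1 ∈ leftLattice Λ) : w ∈ chiralLattice Λ :=
  ⟨h, by
    have h1 := sub_mem hw (mem_leftLattice.1 h)
    rwa [show w - (w.1, 0) = (0, w.2) by ext <;> simp] at h1⟩

lemma mem_chiralLattice_of_snd {Λ : Submodule ℤ (E × F)} {w : E × F} (hw : w ∈ Λ)
    (h : w.2 ∈ rightLattice Λ) : w ∈ chiralLattice Λ :=
  ⟨by
    have h1 := sub_mem hw (mem_rightLattice.1 h)
    rwa [show w - (0, w.2) = (w.1, 0) by ext <;> simp] at h1, h⟩

/-- The lattice with its left- and right-moving parts exchanged. -/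
def swapLattice (Λ : Submodule ℤ (E × F)) : Submodule ℤ (F × E) :=
  Λ.comap (LinearEquiv.prodComm ℤ F E).toLinearMap

lemma mem_swapLattice {Λ : Submodule ℤ (E × F)} {w : F × E} :
    w ∈ swapLattice Λ ↔ w.swap ∈ Λ := Iff.rfl

lemma leftLattice_swapLattice (Λ : Submodule ℤ (E × F)) :
    leftLattice (swapLattice Λ) = rightLattice Λ := rfl

lemma lorentz_swap (v w : E × F) : lorentz v.swap w.swap = -lorentz v w := by
  simp [lorentz]

/-- Exchanging the factors negates the form, which affects neither evenness nor integrality.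
Right-moving statements thereby follow from left-moving ones. -/
lemma IsEvenSelfDualLattice.swap {Λ : Submodule ℤ (E × F)} (h : IsEvenSelfDualLattice Λ) :
    IsEvenSelfDualLattice (swapLattice Λ) where
  discrete := by
    have := h.discrete
    exact DiscreteTopology.of_continuous_injective
      (f := fun w : swapLattice Λ => (⟨(w : F × E).swap, w.2⟩ : Λ)) (by fun_prop)
      fun w w' hw => Subtype.ext (Prod.swap_injective (congrArg Subtype.val hw))
  span_eq_top := by
    have h1 : (swapLattice Λ : Set (F × E)) =
        (LinearEquiv.prodComm ℝ E F).toLinearMap '' (Λ : Set (E × F)) := by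
      ext w
      exact ⟨fun hw => ⟨w.swap, hw, rfl⟩, by rintro ⟨v, hv, rfl⟩; exact hv⟩
    rw [h1, Submodule.span_image, h.span_eq_top, Submodule.map_top, LinearEquiv.range]
  even v hv := by
    obtain ⟨k, hk⟩ := h.even v.swap hv
    refine ⟨-k, ?_⟩
    rw [lorentz_swap] at hk
    push_cast
    linarith
  selfDual v := by
    rw [mem_swapLattice, h.selfDual]
    constructor
    · intro H w hw
      obtain ⟨k, hk⟩ := H w.swap hw
      exact ⟨-k, by rw [lorentz_swap] at hk; push_cast; linarith⟩
    · intro H w hw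
      obtain ⟨k, hk⟩ := H w.swap hw
      refine ⟨-k, ?_⟩
      rw [← neg_eq_iff_eq_neg.2 (lorentz_swap v w.swap), Prod.swap_swap] at hk
      push_cast; linarith

/-- The vectors `r l` of `Λ` represent the cosets of `Λ₀`. -/
structure IsCosetReps (Λ : Submodule ℤ (E × F)) {N : ℕ} (r : Fin N → E × F) : Prop where
  mem : ∀ l, r l ∈ Λ
  exists_sub_mem : ∀ w ∈ Λ, ∃ l, w - r l ∈ chiralLattice Λ
  eq_of_sub_mem : ∀ l l', r l - r l' ∈ chiralLattice Λ → l = l'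

variable {Λ : Submodule ℤ (E × F)} {N : ℕ} {r : Fin N → E × F}

lemma IsCosetReps.swap (hr : IsCosetReps Λ r) :
    IsCosetReps (swapLattice Λ) fun l => (r l).swap where
  mem := hr.mem
  exists_sub_mem w hw := (hr.exists_sub_mem w.swap hw).imp fun _ h => ⟨h.2, h.1⟩
  eq_of_sub_mem l l' h := hr.eq_of_sub_mem l l' ⟨h.2, h.1⟩

lemma moduleLabel_mk_eq_iff (v w : Λ) :
    (Submodule.Quotient.mk v : ModuleLabel Λ) = Submodule.Quotient.mk w ↔
      (v - w : E × F) ∈ chiralLattice Λ :=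
  Submodule.Quotient.eq ((chiralLattice Λ).submoduleOf Λ)

lemma isCosetReps_of_bijective (rep : Fin N → Λ)
    (hrep : Function.Bijective
      (fun l : Fin N => (Submodule.Quotient.mk (rep l) : ModuleLabel Λ))) :
    IsCosetReps Λ fun l => (rep l : E × F) where
  mem l := (rep l).2
  exists_sub_mem w hw := by
    obtain ⟨l, hl⟩ := hrep.2 (Submodule.Quotient.mk ⟨w, hw⟩)
    exact ⟨l, (moduleLabel_mk_eq_iff _ _).1 hl.symm⟩
  eq_of_sub_mem l l' h := hrep.1 ((moduleLabel_mk_eq_iff _ _).2 h)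

lemma IsCosetReps.exists_nsmul_mem (hr : IsCosetReps Λ r) :
    ∃ M : ℕ, M ≠ 0 ∧ ∀ w ∈ Λ, M • w ∈ chiralLattice Λ := by
  have : Finite (ModuleLabel Λ) := by
    refine Finite.of_surjective
      (fun l => (Submodule.Quotient.mk ⟨r l, hr.mem l⟩ : ModuleLabel Λ)) fun q => ?_
    obtain ⟨w, rfl⟩ := Submodule.Quotient.mk_surjective _ q
    obtain ⟨l, hl⟩ := hr.exists_sub_mem w w.2
    exact ⟨l, ((moduleLabel_mk_eq_iff _ _).2 hl).symm⟩
  refine ⟨Nat.card (ModuleLabel Λ), Nat.card_pos.ne', fun w hw => ?_⟩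
  have h := card_nsmul_eq_zero' (x := (Submodule.Quotient.mk ⟨w, hw⟩ : ModuleLabel Λ))
  rw [← Submodule.Quotient.mk_smul, Submodule.Quotient.mk_eq_zero] at h
  exact h

lemma discreteTopology_leftLattice (hΛ : IsEvenSelfDualLattice Λ) :
    DiscreteTopology (leftLattice Λ) := by
  have := hΛ.discrete
  exact DiscreteTopology.of_continuous_injective
    (f := fun x : leftLattice Λ => (⟨((x : E), (0 : F)), x.2⟩ : Λ)) (by fun_prop)
    fun x y hxy => Subtype.ext (congrArg (fun w : Λ => (w : E × F).1) hxy)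

/-- The projection of `Λ` to the left-moving factor. -/
def leftProjection (Λ : Submodule ℤ (E × F)) : Submodule ℤ E :=
  Λ.map (LinearMap.fst ℤ E F)

lemma leftLattice_le_leftProjection : leftLattice Λ ≤ leftProjection Λ :=
  fun _ hx => ⟨_, hx, rfl⟩

lemma span_leftProjection (hΛ : IsEvenSelfDualLattice Λ) :
    Submodule.span ℝ (leftProjection Λ : Set E) = ⊤ := by
  have h : (leftProjection Λ : Set E) = LinearMap.fst ℝ E F '' (Λ : Set (E × F)) := rfl
  rw [h, Submodule.span_image, hΛ.span_eq_top, Submodule.map_top, LinearMap.range_eq_top.2 LinearMap.fst_surjective]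

/-- The Lorentzian product of `(v, 0)` with `w` is `⟨v, w.1⟩`, so self-duality of `Λ` is exactly
this equality. -/
lemma dualLattice_leftProjection (hΛ : IsEvenSelfDualLattice Λ) :
    dualLattice (leftProjection Λ) = leftLattice Λ := by
  ext v
  rw [mem_dualLattice, mem_leftLattice, hΛ.selfDual]
  constructor
  · intro h w hw
    obtain ⟨k, hk⟩ := h w.1 ⟨w, hw, rfl⟩
    exact ⟨k, by simp [lorentz, hk]⟩
  · rintro h _ ⟨w, hw, rfl⟩
    obtain ⟨k, hk⟩ := h w hw
    exact ⟨k, by simpa [lorentz] using hk⟩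

variable [FiniteDimensional ℝ E]

lemma IsCosetReps.span_leftLattice (hΛ : IsEvenSelfDualLattice Λ) (hr : IsCosetReps Λ r) :
    Submodule.span ℝ (leftLattice Λ : Set E) = ⊤ := by
  obtain ⟨M, hM, H⟩ := hr.exists_nsmul_mem
  rw [eq_top_iff, ← span_leftProjection hΛ, Submodule.span_le]
  rintro _ ⟨w, hw, rfl⟩
  have h1 : (M : ℝ) • w.1 ∈ Submodule.span ℝ (leftLattice Λ : Set E) := by
    rw [Nat.cast_smul_eq_nsmul]
    exact Submodule.subset_span (H w hw).1
  exact (Submodule.smul_mem_iff _ (Nat.cast_ne_zero.2 hM)).1 h1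

/-- Multiplication by `M` embeds the projection in the discrete `Λ₁⁰`, so the projection is a
lattice and equals its double dual. -/
lemma IsCosetReps.dualLattice_leftLattice (hΛ : IsEvenSelfDualLattice Λ)
    (hr : IsCosetReps Λ r) : dualLattice (leftLattice Λ) = leftProjection Λ := by
  obtain ⟨M, hM, H⟩ := hr.exists_nsmul_mem
  have := discreteTopology_leftLattice hΛ
  have hd : DiscreteTopology (leftProjection Λ) := by
    have hmem : ∀ x ∈ leftProjection Λ, M • x ∈ leftLattice Λ := by
      rintro _ ⟨w, hw, rfl⟩
      exact (H w hw).1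
    refine DiscreteTopology.of_continuous_injective
      (f := fun x : leftProjection Λ => (⟨M • (x : E), hmem x x.2⟩ : leftLattice Λ))
      (by fun_prop) fun x y hxy => Subtype.ext ?_
    have h1 := congrArg Subtype.val hxy
    simp only [← Nat.cast_smul_eq_nsmul ℝ M] at h1
    exact smul_right_injective E (Nat.cast_ne_zero.2 hM) h1
  have : IsZLattice ℝ (leftProjection Λ) := ⟨span_leftProjection hΛ⟩
  rw [← dualLattice_leftProjection hΛ, dualLattice_dualLattice]

theorem IsCosetReps.isDualReps (hΛ : IsEvenSelfDualLattice Λ) (hr : IsCosetReps Λ r) :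
    IsDualReps (leftLattice Λ) fun l => (r l).1 where
  le_dual := by
    rw [hr.dualLattice_leftLattice hΛ]
    exact leftLattice_le_leftProjection
  mem_dual l := by
    rw [hr.dualLattice_leftLattice hΛ]
    exact ⟨r l, hr.mem l, rfl⟩
  exists_sub_mem v hv := by
    rw [hr.dualLattice_leftLattice hΛ] at hv
    obtain ⟨w, hw, rfl⟩ := hv
    exact (hr.exists_sub_mem w hw).imp fun l h => h.1
  eq_of_sub_mem l l' h := hr.eq_of_sub_mem l l'
    (mem_chiralLattice_of_fst (sub_mem (hr.mem l) (hr.mem l')) h)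
  mem_of_pairing v hv h := by
    rw [← dualLattice_leftProjection hΛ, mem_dualLattice]
    rintro _ ⟨w, hw, rfl⟩
    obtain ⟨l, hl⟩ := hr.exists_sub_mem w hw
    obtain ⟨k, hk⟩ := h l
    obtain ⟨k', hk'⟩ := mem_dualLattice.1 hv _ hl.1
    refine ⟨k + k', ?_⟩
    have : w.1 = (r l).1 + (w - r l).1 := by simp
    rw [LinearMap.fst_apply, this, inner_add_right, hk, hk']
    push_cast; rfl

/-- Adding `(x, 0)` leaves the right component unchanged, so the change in norm is a difference of
two even Lorentzian squares. -/
lemma exists_inner_self_add (hΛ : IsEvenSelfDualLattice Λ) {w : E × F} (hw : w ∈ Λ) {x : E}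
    (hx : x ∈ leftLattice Λ) :
    ∃ k : ℤ, inner ℝ (w.1 + x) (w.1 + x) = inner ℝ w.1 w.1 + 2 * (k : ℝ) := by
  obtain ⟨k, hk⟩ := hΛ.even w hw
  obtain ⟨k', hk'⟩ := hΛ.even _ (add_mem hw (mem_leftLattice.1 hx))
  refine ⟨k' - k, ?_⟩
  simp only [lorentz, Prod.fst_add, Prod.snd_add, add_zero] at hk hk'
  push_cast
  linarith

end LLCFT

/-! ### Transformation laws of the eta function -/

section Eta

lemma eta_add_one (τ : ℂ) :
    ModularForm.eta (τ + 1) = exp (Real.pi * I / 12) * ModularForm.eta τ := by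
  have h1 : ∀ n, ModularForm.eta_q n (τ + 1) = ModularForm.eta_q n τ := by
    intro n
    rw [ModularForm.eta_q_eq_pow, ModularForm.eta_q_eq_pow, mul_add, mul_one, Complex.exp_add,
      Complex.exp_two_pi_mul_I, mul_one]
  have h2 : Function.Periodic.qParam 24 (τ + 1) =
      exp (Real.pi * I / 12) * Function.Periodic.qParam 24 τ := by
    rw [Function.Periodic.qParam, Function.Periodic.qParam, ← Complex.exp_add]
    congr 1
    push_cast
    ring
  simp only [ModularForm.eta, h1]
  rw [h2, mul_assoc]

/-- No branch cut is crossed: `arg (-i) = -π/2` and `0 ≤ arg τ ≤ π` add up within `(-π, π]`, so the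
logarithms add. -/
lemma neg_I_mul_cpow_half {τ : ℂ} (hτ : 0 < τ.im) :
    (-I * τ) ^ (1 / 2 : ℂ) = (Complex.sqrt I)⁻¹ * Complex.sqrt τ := by
  have hτ0 : τ ≠ 0 := by rintro rfl; simp at hτ
  have hI : (-I : ℂ) ≠ 0 := neg_ne_zero.2 I_ne_zero
  have hlog : log (-I * τ) = log (-I) + log τ := by
    rw [Complex.log_mul_eq_add_log_iff hI hτ0, arg_neg_I]
    have h1 := arg_nonneg_iff.2 hτ.le
    have h2 := arg_le_pi τ
    constructor <;> linarith [Real.pi_pos]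
  rw [cpow_def_of_ne_zero (mul_ne_zero hI hτ0), hlog, Complex.sqrt, Complex.sqrt,
    cpow_def_of_ne_zero I_ne_zero, cpow_def_of_ne_zero hτ0, ← Complex.exp_neg, ← Complex.exp_add,
    log_I, log_neg_I]
  congr 1
  ring

lemma eta_neg_one_div {τ : ℂ} (hτ : 0 < τ.im) :
    ModularForm.eta (-1 / τ) = (-I * τ) ^ (1 / 2 : ℂ) * ModularForm.eta τ := by
  have h := ModularForm.eta_comp_eq_csqrt_I_inv (x := τ) hτ
  simp only [Function.comp_apply, Pi.smul_apply, Pi.mul_apply, smul_eq_mul] at h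
  rw [h, neg_I_mul_cpow_half hτ, mul_assoc]

lemma eta_neg_one_div_pow {τ : ℂ} (hτ : 0 < τ.im) (m : ℕ) :
    ModularForm.eta (-1 / τ) ^ m = (-I * τ) ^ (m / 2 : ℂ) * ModularForm.eta τ ^ m := by
  rw [eta_neg_one_div hτ, mul_pow, ← cpow_nat_mul]
  congr 2
  ring

end Eta

/-! ### Characters and the Verlinde sum -/

section Characters

variable {E : Type*} [NormedAddCommGroup E] [InnerProductSpace ℝ E] {L : Submodule ℤ E}

lemma theta_add_one {v : E} (h : ∀ x ∈ L, ∃ k : ℤ,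
      inner ℝ (v + x) (v + x) = inner ℝ v v + 2 * (k : ℝ)) (τ : ℂ) :
    LLCFT.theta L v (τ + 1) = exp (Real.pi * I * (inner ℝ v v : ℝ)) * LLCFT.theta L v τ := by
  rw [LLCFT.theta, LLCFT.theta, ← tsum_mul_left]
  refine tsum_congr fun x => ?_
  obtain ⟨k, hk⟩ := h x x.2
  rw [LLCFT.thetaTerm, LLCFT.thetaTerm, ← Complex.exp_add, Complex.exp_eq_exp_iff_exists_int]
  refine ⟨k, ?_⟩
  rw [hk]
  push_cast
  ring

lemma theta_div_eta_add_one {v : E} (h : ∀ x ∈ L, ∃ k : ℤ,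
      inner ℝ (v + x) (v + x) = inner ℝ v v + 2 * (k : ℝ)) (τ : ℂ) (m : ℕ) :
    LLCFT.theta L v (τ + 1) / ModularForm.eta (τ + 1) ^ m =
      exp (Real.pi * I * ((inner ℝ v v : ℝ) - (m : ℂ) / 12)) *
        (LLCFT.theta L v τ / ModularForm.eta τ ^ m) := by
  rw [theta_add_one h, eta_add_one, mul_pow, ← Complex.exp_nat_mul, mul_div_mul_comm,
    ← Complex.exp_sub]
  congr 2
  ring

lemma IsDualReps.theta_div_eta_inversion [FiniteDimensional ℝ E] [DiscreteTopology L]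
    [IsZLattice ℝ L] {N : ℕ} {α : Fin N → E} (h : IsDualReps L α) {τ : ℂ} (hτ : 0 < τ.im)
    (l : Fin N) :
    LLCFT.theta L (α l) (-1 / τ) / ModularForm.eta (-1 / τ) ^ Module.finrank ℝ E =
      ∑ l', 1 / (Real.sqrt N : ℂ) * phase (α l) (α l') *
        (LLCFT.theta L (α l') τ / ModularForm.eta τ ^ Module.finrank ℝ E) := by
  have hτ0 : τ ≠ 0 := by rintro rfl; simp at hτ
  rw [h.theta_inversion hτ, eta_neg_one_div_pow hτ, mul_div_mul_left, Finset.sum_div]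
  · simp only [mul_div_assoc]
  · rw [Ne, cpow_eq_zero_iff]
    simp [hτ0]

-- The phases combine into that of `α i + α j - α k`, the denominator phase being `1` since `α o ∈
-- L`; the prefactors leave `1/N`, and `sum_phase` finishes.
open Classical in
lemma IsDualReps.verlinde {N : ℕ} {α : Fin N → E} (h : IsDualReps L α) {o : Fin N}
    (ho : α o ∈ L) (i j k : Fin N) :
    (if α k - (α i + α j) ∈ L then 1 else 0 : ℂ) =
      ∑ l, 1 / (Real.sqrt N : ℂ) * phase (α i) (α l) * (1 / (Real.sqrt N : ℂ) * phase (α j) (α l)) *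
        star (1 / (Real.sqrt N : ℂ) * phase (α l) (α k)) /
          (1 / (Real.sqrt N : ℂ) * phase (α o) (α l)) := by
  have hN : (N : ℝ) ≠ 0 := Nat.cast_ne_zero.2 (Fin.pos o).ne'
  have hs : (Real.sqrt N : ℂ) ≠ 0 :=
    ofReal_ne_zero.2 (Real.sqrt_ne_zero'.2 (Nat.cast_pos.2 (Fin.pos o)))
  have hs2 : (Real.sqrt N : ℂ) ^ 2 = N := by
    rw [← ofReal_pow, Real.sq_sqrt (Nat.cast_nonneg N), ofReal_natCast]
  have hterm : ∀ l, 1 / (Real.sqrt N : ℂ) * phase (α i) (α l) *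
      (1 / (Real.sqrt N : ℂ) * phase (α j) (α l)) *
        star (1 / (Real.sqrt N : ℂ) * phase (α l) (α k)) /
          (1 / (Real.sqrt N : ℂ) * phase (α o) (α l)) =
      1 / N * phase (α i + α j - α k) (α l) := by
    intro l
    have ho1 : phase (α o) (α l) = 1 := by
      rw [phase_comm, phase_eq_one_iff]
      exact mem_dualLattice.1 (h.mem_dual l) _ ho
    rw [ho1, phase_comm (α l), star_mul', star_phase, sub_eq_add_neg, phase_add_left,
      phase_add_left, ← hs2]
    have : star (1 / (Real.sqrt N : ℂ)) = 1 / (Real.sqrt N : ℂ) := by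
      rw [← starRingEnd_apply, map_div₀, map_one, conj_ofReal]
    rw [this]
    field_simp
  rw [Finset.sum_congr rfl fun l _ => hterm l, ← Finset.mul_sum,
    h.sum_phase (sub_mem (add_mem (h.mem_dual i) (h.mem_dual j)) (h.mem_dual k)),
    ← neg_mem_iff, neg_sub]
  split_ifs
  · rw [one_div, inv_mul_cancel₀ (by exact_mod_cast hN)]
  · rw [mul_zero]

end Characters

/-! ### Fusion coefficients and the main theorem -/

namespace LLCFT

variable {E F : Type*} [NormedAddCommGroup E] [InnerProductSpace ℝ E]
  [NormedAddCommGroup F] [InnerProductSpace ℝ F]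

lemma fusionCoeff_eq {Λ : Submodule ℤ (E × F)} (u v w : Λ) (p : Prop) [Decidable p]
    (hp : p ↔ (w - (u + v) : E × F) ∈ chiralLattice Λ) :
    (fusionCoeff Λ (Submodule.Quotient.mk u) (Submodule.Quotient.mk v)
      (Submodule.Quotient.mk w) : ℂ) = if p then 1 else 0 := by
  rw [fusionCoeff, ← Submodule.Quotient.mk_add]
  simp only [moduleLabel_mk_eq_iff, Submodule.coe_add, ← hp]
  split_ifs <;> simp

end LLCFT

theorem mainTheorem2 {E F : Type*}
    [NormedAddCommGroup E] [InnerProductSpace ℝ E] [FiniteDimensional ℝ E]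
    [NormedAddCommGroup F] [InnerProductSpace ℝ F] [FiniteDimensional ℝ F]
    (m n : ℕ) (hm : Module.finrank ℝ E = m) (hn : Module.finrank ℝ F = n)
    (Λ : Submodule ℤ (E × F)) (hΛ : LLCFT.IsEvenSelfDualLattice Λ)
    (hrat : LLCFT.IsRational Λ)
    (N : ℕ) (hN : Nat.card (LLCFT.ModuleLabel Λ) = N)
    (rep : Fin N → Λ)
    (hrep : Function.Bijective
      (fun l : Fin N => (Submodule.Quotient.mk (rep l) : LLCFT.ModuleLabel Λ)))
    (α : Fin N → E) (hα : ∀ l, α l = (rep l : E × F).1)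
    (β : Fin N → F) (hβ : ∀ l, β l = (rep l : E × F).2)
    (o : Fin N) (ho : (Submodule.Quotient.mk (rep o) : LLCFT.ModuleLabel Λ) = 0) :
    -- the series that define the characters converge absolutely on the upper half-plane
    (∀ (l : Fin N) (τ : ℂ), 0 < τ.im →
      Summable (LLCFT.thetaTerm (LLCFT.leftLattice Λ) (α l) τ) ∧
      Summable (LLCFT.thetaTerm (LLCFT.rightLattice Λ) (β l) τ)) ∧
    ∃ TL TR SL SR : Matrix (Fin N) (Fin N) ℂ,
      -- the explicit matrices
      (TL = Matrix.diagonal fun l =>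
        Complex.exp (Real.pi * Complex.I * ((inner ℝ (α l) (α l) : ℝ) - (m : ℂ) / 12))) ∧
      (TR = Matrix.diagonal fun l =>
        Complex.exp (Real.pi * Complex.I * ((inner ℝ (β l) (β l) : ℝ) - (n : ℂ) / 12))) ∧
      (SL = Matrix.of fun l l' => 1 / (Real.sqrt N : ℂ) *
        Complex.exp (-2 * Real.pi * Complex.I * (inner ℝ (α l) (α l') : ℝ))) ∧
      (SR = Matrix.of fun l l' => 1 / (Real.sqrt N : ℂ) *
        Complex.exp (-2 * Real.pi * Complex.I * (inner ℝ (β l) (β l') : ℝ))) ∧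
      -- the transformation laws of the characters
      (∀ (l : Fin N) (τ : ℂ), 0 < τ.im →
        LLCFT.leftCharacter Λ (α l) (τ + 1) =
          ∑ l' : Fin N, TL l l' * LLCFT.leftCharacter Λ (α l') τ ∧
        LLCFT.rightCharacter Λ (β l) (τ + 1) =
          ∑ l' : Fin N, TR l l' * LLCFT.rightCharacter Λ (β l') τ ∧
        LLCFT.leftCharacter Λ (α l) (-1 / τ) =
          ∑ l' : Fin N, SL l l' * LLCFT.leftCharacter Λ (α l') τ ∧
        LLCFT.rightCharacter Λ (β l) (-1 / τ) =
          ∑ l' : Fin N, SR l l' * LLCFT.rightCharacter Λ (β l') τ) ∧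
      -- the left and right matrices agree
      ((m : ℤ) - (n : ℤ) ≡ 0 [ZMOD 24] → TL = TR ∧ SL = SR) ∧
      -- the Verlinde formula on both sides
      LLCFT.VerlindeFormula Λ rep o SL ∧ LLCFT.VerlindeFormula Λ rep o SR := by
  classical
  obtain rfl : α = fun l => (rep l : E × F).1 := funext hα
  obtain rfl : β = fun l => (rep l : E × F).2 := funext hβ
  subst hm hn
  have hr := LLCFT.isCosetReps_of_bijective rep hrep
  have hL : IsDualReps (LLCFT.leftLattice Λ) fun l => (rep l : E × F).1 := hr.isDualReps hΛ
  have hR : IsDualReps (LLCFT.rightLattice Λ) fun l => (rep l : E × F).2 :=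
    hr.swap.isDualReps hΛ.swap
  have hdL : DiscreteTopology (LLCFT.leftLattice Λ) := LLCFT.discreteTopology_leftLattice hΛ
  have hdR : DiscreteTopology (LLCFT.rightLattice Λ) :=
    LLCFT.discreteTopology_leftLattice hΛ.swap
  have hzL : IsZLattice ℝ (LLCFT.leftLattice Λ) := ⟨hr.span_leftLattice hΛ⟩
  have hsR := hr.swap.span_leftLattice hΛ.swap
  rw [LLCFT.leftLattice_swapLattice] at hsR
  have hzR : IsZLattice ℝ (LLCFT.rightLattice Λ) := ⟨hsR⟩
  have hoc : (rep o : E × F) ∈ LLCFT.chiralLattice Λ :=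
    (Submodule.Quotient.mk_eq_zero ((LLCFT.chiralLattice Λ).submoduleOf Λ)).1 ho
  have heL : ∀ l, ∀ x ∈ LLCFT.leftLattice Λ, ∃ k : ℤ,
      inner ℝ ((rep l : E × F).1 + x) ((rep l : E × F).1 + x) =
        inner ℝ (rep l : E × F).1 (rep l : E × F).1 + 2 * (k : ℝ) :=
    fun l _ hx => LLCFT.exists_inner_self_add hΛ (rep l).2 hx
  have heR : ∀ l, ∀ y ∈ LLCFT.rightLattice Λ, ∃ k : ℤ,
      inner ℝ ((rep l : E × F).2 + y) ((rep l : E × F).2 + y) =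
        inner ℝ (rep l : E × F).2 (rep l : E × F).2 + 2 * (k : ℝ) :=
    fun l _ hy => LLCFT.exists_inner_self_add hΛ.swap (hr.swap.mem l) hy
  refine ⟨fun l τ hτ => ⟨summable_thetaTerm _ _ hτ, summable_thetaTerm _ _ hτ⟩,
    _, _, _, _, rfl, rfl, rfl, rfl, fun l τ hτ => ⟨?_, ?_, ?_, ?_⟩, fun hmn => ⟨?_, ?_⟩, ?_, ?_⟩
  · simp only [Matrix.diagonal_apply, ite_mul, zero_mul, Finset.sum_ite_eq, Finset.mem_univ, if_true]
    exact theta_div_eta_add_one (heL l) τ _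
  · simp only [Matrix.diagonal_apply, ite_mul, zero_mul, Finset.sum_ite_eq, Finset.mem_univ, if_true]
    exact theta_div_eta_add_one (heR l) τ _
  · exact hL.theta_div_eta_inversion hτ l
  · exact hR.theta_div_eta_inversion hτ l
  · congr 1
    funext l
    obtain ⟨k, hk⟩ := hΛ.even _ (rep l).2
    obtain ⟨d, hd⟩ := (Int.modEq_zero_iff_dvd.1 hmn)
    have hd' : (Module.finrank ℝ E : ℂ) - Module.finrank ℝ F = 24 * d := by exact_mod_cast hd
    have hk' : (inner ℝ (rep l : E × F).1 (rep l : E × F).1 : ℂ) -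
        (inner ℝ (rep l : E × F).2 (rep l : E × F).2 : ℝ) = 2 * k := by
      exact_mod_cast hk
    rw [Complex.exp_eq_exp_iff_exists_int]
    -- The norms differ by `2k` and the dimensions by `24d`, so the exponents differ by `πi(2k -
    -- 24d/12) = 2πi(k - d)`.
    refine ⟨k - d, ?_⟩
    push_cast
    linear_combination (Real.pi * I) * hk' - (Real.pi * I / 12) * hd'
  · congr 1
    funext l l'
    obtain ⟨k, hk⟩ := (hΛ.selfDual _).1 (rep l).2 _ (rep l').2
    have hk' : (inner ℝ (rep l : E × F).1 (rep l' : E × F).1 : ℂ) -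
        (inner ℝ (rep l : E × F).2 (rep l' : E × F).2 : ℝ) = k := by
      exact_mod_cast hk
    congr 1
    rw [Complex.exp_eq_exp_iff_exists_int]
    refine ⟨-k, ?_⟩
    push_cast
    linear_combination (-2 * Real.pi * I) * hk'
  · intro i j k
    rw [LLCFT.fusionCoeff_eq (rep i) (rep j) (rep k)
      ((rep k : E × F).1 - ((rep i : E × F).1 + (rep j : E × F).1) ∈ LLCFT.leftLattice Λ)
      ⟨fun h => LLCFT.mem_chiralLattice_of_fst
        (sub_mem (rep k).2 (add_mem (rep i).2 (rep j).2)) h, fun h => h.1⟩]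
    exact hL.verlinde hoc.1 i j k
  · intro i j k
    rw [LLCFT.fusionCoeff_eq (rep i) (rep j) (rep k)
      ((rep k : E × F).2 - ((rep i : E × F).2 + (rep j : E × F).2) ∈ LLCFT.rightLattice Λ)
      ⟨fun h => LLCFT.mem_chiralLattice_of_snd
        (sub_mem (rep k).2 (add_mem (rep i).2 (rep j).2)) h, fun h => h.2⟩]
    exact hR.verlinde hoc.2 i j k
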